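/- Let $I$ be a finite non-empty set. Formulas are built from the variables $p_0,p_1,\dots$ and $\bot$ by $\to$, $\Box_i$ ($i\in I$) and $\mathsf C$; the other Boolean connectives are the usual abbreviations, and $\mathsf E\varphi:=\bigwedge_{i\in I}\Box_i\varphi$. The logic $\mathsf{S4}^{C}_I$ has as axioms all (instances of) classical tautologies, $\Box_i(\varphi\to\psi)\to(\Box_i\varphi\to\Box_i\psi)$, $\Box_i\varphi\to\Box_i\Box_i\varphi$, $\Box_i\varphi\to\varphi$, $\mathsf C(\varphi\to\psi)\to(\mathsf C\varphi\to\mathsf C\psi)$, $\mathsf C\varphi\to\mathsf E\varphi\wedge\mathsf E\mathsf C\varphi$, and $\mathsf E\varphi\wedge\mathsf C(\varphi\to\mathsf E\varphi)\to\mathsf C\varphi$, and as rules (mp) from $\varphi$ and $\varphi\to\psi$ infer $\psi$, and (nec) from $\varphi$ infer $\mathsf C\varphi$. Derivability. $\Gamma\vdash_l\varphi$ means that $\mathsf{S4}^{C}_I\vdash\bigwedge\Gamma_0\to\varphi$ for some finite $\Gamma_0\subseteq\Gamma$. An $\omega$-derivation is a well-founded tree of formulas constructed by (mp), (nec) and the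 rule $(\omega)$: from $\varphi_n\to\mathsf E\psi\wedge\mathsf E\varphi_{n+1}$ for all $n\in\mathbb N$ infer $\varphi_0\to\mathsf C\psi$. $\Sigma\vdash_g\varphi$ means that there is an $\omega$-derivation with root $\varphi$ in which every leaf that is not an axiom of $\mathsf{S4}^{C}_I$ belongs to $\Sigma$. Algebraic consequence. An interior algebra is a Boolean algebra with a map $\Box$ such that $\Box1=1$, $\Box(x\wedge y)=\Box x\wedge\Box y$, $\Box x=\Box\Box x$, $\Box x\le x$. An $\mathsf{S4}^{C}_I$-algebra is a Boolean algebra $A$ with maps $\Box_i$ ($i\in I$) and $\mathsf C$, each making $A$ an interior algebra, such that $\mathsf Ca\le\mathsf Ea\wedge\mathsf E\mathsf Ca$ and $\mathsf Ea\wedge\mathsf C(a\to\mathsf Ea)\le\mathsf Ca$ for all $a$, where $\mathsf Ea=\bigwedge_{i\in I}\Box_ia$. It is standard if $a_0\le\mathsf Cd$ whenever $a_j\le\mathsf Ed\wedge\mathsf Ea_{j+1}$ for all $j\in\mathbb N$. A valuation maps formulas to elements of $A$ and commutes with $\bot,\to,\Box_i,\mathsf C$. $\Gamma\Vdash_l\varphi$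 means that $v(\varphi)$ lies in the filter generated by $\{v(\psi)\mid\psi\in\Gamma\}$ for every valuation $v$ in every standard $\mathsf{S4}^{C}_I$-algebra. $\Sigma\Vdash_g\varphi$ means that for every such $v$, if $v(\xi)=1$ for all $\xi\in\Sigma$, then $v(\varphi)=1$. Topological consequence. A topological model is a set $X$ with topologies $(\tau_i)_{i\in I}$ and a map $v$ from formulas to subsets of $X$ such that $v(\bot)=\emptyset$, $v(\varphi\to\psi)=v(\psi)\cup(X\setminus v(\varphi))$, $v(\Box_i\varphi)$ is the $\tau_i$-interior of $v(\varphi)$, and $v(\mathsf C\varphi)$ is the $\tau$-interior of $v(\varphi)$, where $\tau=\bigcap_{i\in I}\tau_i$. $\Gamma\vDash_l\varphi$ means that in every topological model, every point that lies in $v(\psi)$ for all $\psi\in\Gamma$ lies in $v(\varphi)$. $\Sigma\vDash_g\varphi$ means that in every topological model with $v(\xi)=X$ for all $\xi\in\Sigma$ one has $v(\varphi)=X$. Corollary (local and global completeness). For all sets of formulas $\Sigma$, $\Gamma$ and every formula $\varphi$, $$\Gamma\vdash_l\varphi\iff\Gamma\Vdash_l\varphi\iff\Gamma\vDash_l\varphi,\qquad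 \Sigma\vdash_g\varphi\iff\Sigma\Vdash_g\varphi\iff\Sigma\vDash_g\varphi.$$ -/

import Mathlib

universe u v w

namespace S4C

/-! ## Formulas -/

/-- Formulas of `S4^C_I`, over the propositional variables `p 0, p 1, …`. -/
inductive Formula (I : Type u) : Type u
  | var : ℕ → Formula I
  | bot : Formula I
  | imp : Formula I → Formula I → Formula I
  | box : I → Formula I → Formula I
  | common : Formula I → Formula I

namespace Formula

variable {I : Type u}

/-- `¬ φ := φ → ⊥`. -/
def neg (φ : Formula I) : Formula I := imp φ bot

/-- `⊤ := ¬ ⊥`. -/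
def top : Formula I := neg bot

/-- `φ ∧ ψ := ¬ (φ → ¬ ψ)`. -/
def and (φ ψ : Formula I) : Formula I := neg (imp φ (neg ψ))

/-- Finite conjunctions; the empty one is `⊤`. -/
def conj : List (Formula I) → Formula I
  | [] => top
  | [φ] => φ
  | φ :: ψ :: l => and φ (conj (ψ :: l))

/-- Mutual knowledge `E φ := ⋀_{i ∈ I} □_i φ` (the agents are taken in some fixed order). -/
noncomputable def everyone [Fintype I] (φ : Formula I) : Formula I :=
  conj ((Finset.univ : Finset I).toList.map fun i => box i φ)

/-- `φ` is (an instance of) a classical propositional tautology: it is true under every Boolean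
truth assignment, where variables and formulas `□_i ψ`, `C ψ` count as atoms. -/
def IsTautology (φ : Formula I) : Prop :=
  ∀ e : Formula I → Prop, ¬ e bot → (∀ α β, e (imp α β) ↔ (e α → e β)) → e φ

end Formula

open Formula

/-! ## The Hilbert calculus and its derivability relations -/

section Calculus

variable {I : Type u} [Fintype I]

/-- The axioms of `S4^C_I`. -/
inductive IsAxiom : Formula I → Prop
  | taut {φ : Formula I} : IsTautology φ → IsAxiom φ
  | box_k (i : I) (φ ψ : Formula I) :
      IsAxiom (imp (box i (imp φ ψ)) (imp (box i φ) (box i ψ)))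
  | box_four (i : I) (φ : Formula I) : IsAxiom (imp (box i φ) (box i (box i φ)))
  | box_t (i : I) (φ : Formula I) : IsAxiom (imp (box i φ) φ)
  | common_k (φ ψ : Formula I) :
      IsAxiom (imp (common (imp φ ψ)) (imp (common φ) (common ψ)))
  | common_fix (φ : Formula I) :
      IsAxiom (imp (common φ) (Formula.and (everyone φ) (everyone (common φ))))
  | common_ind (φ : Formula I) :
      IsAxiom (imp (Formula.and (everyone φ) (common (imp φ (everyone φ)))) (common φ))

/-- `S4^C_I ⊢ φ`. -/
inductive Provable : Formula I → Prop
  | ax {φ : Formula I} : IsAxiom φ → Provable φ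
  | mp {φ ψ : Formula I} : Provable φ → Provable (imp φ ψ) → Provable ψ
  | nec {φ : Formula I} : Provable φ → Provable (common φ)

/-- `Γ ⊢_l φ`: some finite `Γ₀ ⊆ Γ` has `S4^C_I ⊢ ⋀ Γ₀ → φ`. -/
def LocalDerivable (Γ : Set (Formula I)) (φ : Formula I) : Prop :=
  ∃ Γ₀ : Finset (Formula I), (Γ₀ : Set (Formula I)) ⊆ Γ ∧ Provable (imp (conj Γ₀.toList) φ)

/-- `ω`-derivations with root `φ`: well-founded trees, whose leaves may carry any formula, built by
the rules `mp`, `nec` and `ω` (from `φ_n → E ψ ∧ E φ_{n+1}` for all `n`, infer `φ_0 → C ψ`). -/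
inductive OmegaDerivation : Formula I → Type u
  | leaf (φ : Formula I) : OmegaDerivation φ
  | mp {φ ψ : Formula I} :
      OmegaDerivation φ → OmegaDerivation (imp φ ψ) → OmegaDerivation ψ
  | nec {φ : Formula I} : OmegaDerivation φ → OmegaDerivation (common φ)
  | omega (φ : ℕ → Formula I) (ψ : Formula I) :
      (∀ n, OmegaDerivation (imp (φ n) (Formula.and (everyone ψ) (everyone (φ (n + 1)))))) →
      OmegaDerivation (imp (φ 0) (common ψ))

/-- The marks of the assumption leaves, i.e. of the leaves not marked by an axiom. -/
def OmegaDerivation.assumptions : {φ : Formula I} → OmegaDerivation φ → Set (Formula I)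
  | _, .leaf φ => {χ | χ = φ ∧ ¬ IsAxiom φ}
  | _, .mp p q => p.assumptions ∪ q.assumptions
  | _, .nec p => p.assumptions
  | _, .omega _ _ p => ⋃ n, (p n).assumptions

/-- `Δ ⊢_g φ`: there is an `ω`-derivation of `φ` all of whose assumption leaves are marked by
elements of `Δ`. -/
def GlobalDerivable (Δ : Set (Formula I)) (φ : Formula I) : Prop :=
  ∃ π : OmegaDerivation φ, π.assumptions ⊆ Δ

end Calculus

/-! ## Algebraic semantics -/

/-- `(A, f)` is an interior algebra. -/
structure IsInteriorOperator {A : Type v} [BooleanAlgebra A] (f : A → A) : Prop where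
  map_top : f ⊤ = ⊤
  map_inf : ∀ a b, f (a ⊓ b) = f a ⊓ f b
  idem : ∀ a, f a = f (f a)
  le_self : ∀ a, f a ≤ a

/-- An `S4^C_I`-algebra structure on the Boolean algebra `A`; here
`Finset.univ.inf fun i => box i a` is `E a = ⋀_{i ∈ I} □_i a`. -/
structure CKAlgebra (I : Type u) [Fintype I] (A : Type v) [BooleanAlgebra A] where
  box : I → A → A
  common : A → A
  box_interior : ∀ i, IsInteriorOperator (box i)
  common_interior : IsInteriorOperator common
  common_le : ∀ a, common a ≤
    (Finset.univ.inf fun i => box i a) ⊓ (Finset.univ.inf fun i => box i (common a))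
  ind : ∀ a, (Finset.univ.inf fun i => box i a) ⊓
    common (a ⇨ Finset.univ.inf fun i => box i a) ≤ common a

namespace CKAlgebra

variable {I : Type u} [Fintype I] {A : Type v} [BooleanAlgebra A]

/-- `E a = ⋀_{i ∈ I} □_i a`. -/
def everyone (𝒜 : CKAlgebra I A) (a : A) : A := Finset.univ.inf fun i => 𝒜.box i a

/-- Standard algebras: if `a_j ≤ E d ∧ E a_{j+1}` for all `j`, then `a_0 ≤ C d`. -/
def IsStandard (𝒜 : CKAlgebra I A) : Prop :=
  ∀ (d : A) (a : ℕ → A), (∀ j, a j ≤ 𝒜.everyone d ⊓ 𝒜.everyone (a (j + 1))) → a 0 ≤ 𝒜.common d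

/-- Valuations in an `S4^C_I`-algebra. -/
structure IsValuation (𝒜 : CKAlgebra I A) (val : Formula I → A) : Prop where
  map_bot : val Formula.bot = ⊥
  map_imp : ∀ φ ψ, val (Formula.imp φ ψ) = val φ ⇨ val ψ
  map_box : ∀ i φ, val (Formula.box i φ) = 𝒜.box i (val φ)
  map_common : ∀ φ, val (Formula.common φ) = 𝒜.common (val φ)

end CKAlgebra

/-- The filter generated by `S`: the intersection of all (not necessarily proper) filters
that contain `S`. -/
def generatedFilter {A : Type v} [BooleanAlgebra A] (S : Set A) : Set A :=
  {a | ∀ F : Order.PFilter A, S ⊆ (F : Set A) → a ∈ F}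

/-- `Γ ⊩_l φ`. -/
def AlgLocalConsequence {I : Type u} [Fintype I] (Γ : Set (Formula I)) (φ : Formula I) : Prop :=
  ∀ (A : Type v) [BooleanAlgebra A] (𝒜 : CKAlgebra I A), 𝒜.IsStandard →
    ∀ val : Formula I → A, 𝒜.IsValuation val → val φ ∈ generatedFilter (val '' Γ)

/-- `Δ ⊩_g φ`. -/
def AlgGlobalConsequence {I : Type u} [Fintype I] (Δ : Set (Formula I)) (φ : Formula I) : Prop :=
  ∀ (A : Type v) [BooleanAlgebra A] (𝒜 : CKAlgebra I A), 𝒜.IsStandard →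
    ∀ val : Formula I → A, 𝒜.IsValuation val → (∀ ξ ∈ Δ, val ξ = ⊤) → val φ = ⊤

/-! ## Topological semantics -/

/-- Topological `S4^C_I`-models. In Mathlib's order on topologies the supremum `⨆ i, τ i` is the
topology whose open sets are those open in every `τ i`, i.e. the intersection `⋂ i, τ i` of the
families of open sets. -/
structure TopModel (I : Type u) where
  X : Type w
  τ : I → TopologicalSpace X
  val : Formula I → Set X
  val_bot : val bot = ∅
  val_imp : ∀ φ ψ, val (imp φ ψ) = val ψ ∪ (val φ)ᶜ
  val_box : ∀ i φ, val (box i φ) = @interior X (τ i) (val φ)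
  val_common : ∀ φ, val (common φ) = @interior X (⨆ i, τ i) (val φ)

/-- `M, x ⊨ φ`. -/
def TopModel.TrueAt {I : Type u} (M : TopModel.{u, w} I) (x : M.X) (φ : Formula I) : Prop :=
  x ∈ M.val φ

/-- `M ⊨ φ`. -/
def TopModel.IsTrue {I : Type u} (M : TopModel.{u, w} I) (φ : Formula I) : Prop :=
  ∀ x : M.X, M.TrueAt x φ

/-- `Γ ⊨_l φ`. -/
def TopLocalConsequence {I : Type u} (Γ : Set (Formula I)) (φ : Formula I) : Prop :=
  ∀ (M : TopModel.{u, w} I) (x : M.X), (∀ ψ ∈ Γ, M.TrueAt x ψ) → M.TrueAt x φ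

/-- `Δ ⊨_g φ`. -/
def TopGlobalConsequence {I : Type u} (Δ : Set (Formula I)) (φ : Formula I) : Prop :=
  ∀ M : TopModel.{u, w} I, (∀ ξ ∈ Δ, M.IsTrue ξ) → M.IsTrue φ

end S4C

/-!
Soundness for algebras is an induction on derivations; tautologies are handled by the Boolean prime
ideal theorem. The subsets of a topological model form a standard algebra, because the union of a
chain `a 0, a 1, …` with `a j ≤ E d ⊓ E a (j + 1)` is open in every topology. So algebraic
consequence implies topological consequence, and it remains to prove topological completeness.

For this, let `T` be a theory, that is, a set of formulas containing the axioms and closed under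
`mp` and `nec`. The points of `T` are the truth assignments at which all of `T` holds. Propositional
compactness (an ultraproduct argument, `exists_finset_entails`) shows that the formulas true at all
points are exactly those of `T`. Give the set of points the topologies `τ i` with basic open sets
`{x | x ⊨ □_i ψ}`. The `τ i`-interior of the set defined by `φ` is the set defined by `□_i φ`. If
`T` is closed under the `ω`-rule, then the interior in `⋂ τ i` is given by `C φ`: when `U` is open
in every `τ i` and contained in the set defined by `φ`, compactness yields, for any formula `χ` with
truth set inside `U`, another such formula `χ'` with `χ → E χ'` in `T`
(`exists_everyone_of_truthSet_subset`). Iterating and applying the `ω`-rule gives `χ → C φ`.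

Global completeness follows by taking for `T` the formulas globally derivable from `Δ`. Local
completeness follows by taking for `T` the theorems of the finitary calculus; here closure under the
`ω`-rule is not part of the definition, and is obtained from a filtration (`omegaClosed_provable`).
Given `θ`, the points of the finitary calculus carry preorders comparing the formulas `□_i χ` in a
finite set of formulas attached to `θ`. The up-sets of these preorders are topologies, in which the
truth lemma holds for `θ`: a set that is open in all of them is defined by a formula `δ` with
`δ → E δ` provable, so the induction axiom applies to it. Since the `ω`-rule is sound in topological
models, a formula `θ` that is `ω`-derivable without assumptions is true at all points, hence provable.

Points live in the universe of `I`; as `I` is finite, the models can be moved to any universe.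
-/

namespace S4C

open Formula
open scoped Topology

/-! ### Truth assignments and compactness -/

section Assignments

variable {I : Type u}

/-- Boolean truth assignments, for which variables and formulas `□_i ψ`, `C ψ` are atoms. -/
structure IsAssignment (e : Formula I → Prop) : Prop where
  not_bot : ¬ e bot
  imp_iff : ∀ α β, e (imp α β) ↔ (e α → e β)

namespace IsAssignment

variable {e : Formula I → Prop} (he : IsAssignment e)
include he

theorem neg_iff (φ : Formula I) : e (neg φ) ↔ ¬ e φ := by
  simp [Formula.neg, he.imp_iff, he.not_bot]

theorem top_holds : e top := by
  simp [Formula.top, he.neg_iff, he.not_bot]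

theorem and_iff (φ ψ : Formula I) : e (Formula.and φ ψ) ↔ e φ ∧ e ψ := by
  simp [Formula.and, he.neg_iff, he.imp_iff]

theorem conj_iff (l : List (Formula I)) : e (conj l) ↔ ∀ φ ∈ l, e φ := by
  induction l with
  | nil => simp [conj, he.top_holds]
  | cons φ l ih =>
    cases l with
    | nil => simp [conj]
    | cons ψ l => simp only [conj, he.and_iff, ih, List.forall_mem_cons]

theorem everyone_iff [Fintype I] (φ : Formula I) : e (everyone φ) ↔ ∀ i, e (box i φ) := by
  simp [everyone, he.conj_iff]

theorem foldr_imp_iff (l : List (Formula I)) (φ : Formula I) :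
    e (l.foldr imp φ) ↔ ((∀ ψ ∈ l, e ψ) → e φ) := by
  induction l with
  | nil => simp
  | cons ψ l ih => simp [he.imp_iff, ih]

end IsAssignment

theorem isTautology_of_forall {φ : Formula I} (h : ∀ e, IsAssignment e → e φ) : IsTautology φ :=
  fun e h₀ h₁ => h e ⟨h₀, h₁⟩

/-- Compactness of classical propositional logic. A counterexample for `S` is an ultraproduct of
counterexamples for the finite subsets of `S`. -/
theorem exists_finset_entails {S : Set (Formula I)} {φ : Formula I}
    (h : ∀ e, IsAssignment e → (∀ χ ∈ S, e χ) → e φ) :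
    ∃ F : Finset (Formula I), (F : Set (Formula I)) ⊆ S ∧
      ∀ e, IsAssignment e → (∀ χ ∈ F, e χ) → e φ := by
  classical
  by_contra! hF
  have hF' : ∀ F : Finset S, ∃ e, IsAssignment e ∧ (∀ χ ∈ F, e χ.1) ∧ ¬ e φ := by
    intro F
    obtain ⟨e, he, h₁, h₂⟩ := hF (F.image Subtype.val) (by
      intro χ hχ
      simp only [Finset.coe_image, Set.mem_image] at hχ
      obtain ⟨y, -, rfl⟩ := hχ
      exact y.2)
    exact ⟨e, he, fun χ hχ => h₁ _ (Finset.mem_image_of_mem _ hχ), h₂⟩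
  choose e he hS hφ using hF'
  let U : Ultrafilter (Finset S) := Ultrafilter.of Filter.atTop
  have hU : (U : Filter (Finset S)) ≤ Filter.atTop := Ultrafilter.of_le _
  have key := h (fun χ => ∀ᶠ F in U, e F χ) ⟨by simp [(he _).not_bot, U.neBot.ne], fun α β => by
    simp only [(he _).imp_iff, Ultrafilter.eventually_imp]⟩ (fun χ hχ => by
      refine Filter.Eventually.filter_mono hU ?_
      filter_upwards [Filter.eventually_ge_atTop ({⟨χ, hχ⟩} : Finset S)] with F hle
      exact hS F ⟨χ, hχ⟩ (hle (Finset.mem_singleton_self _)))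
  obtain ⟨F, hF⟩ := key.exists
  exact hφ F hF

end Assignments

/-! ### Theories and their points -/

section Theories

variable {I : Type u}

/-- The points of `T`: truth assignments at which every formula of `T` is true. -/
def Point (T : Set (Formula I)) : Type u :=
  {e : Formula I → Prop // IsAssignment e ∧ ∀ φ ∈ T, e φ}

instance (T : Set (Formula I)) : CoeFun (Point T) fun _ => Formula I → Prop := ⟨Subtype.val⟩

variable {T : Set (Formula I)}

theorem Point.isAssignment (x : Point T) : IsAssignment x := x.2.1

theorem Point.holds_of_mem (x : Point T) {φ : Formula I} (h : φ ∈ T) : x φ := x.2.2 φ h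

variable [Fintype I]

/-- Sets of formulas that contain the axioms and are closed under `mp` and `nec`. -/
structure IsTheory (T : Set (Formula I)) : Prop where
  ax : ∀ {φ}, IsAxiom φ → φ ∈ T
  mp : ∀ {φ ψ}, φ ∈ T → imp φ ψ ∈ T → ψ ∈ T
  nec : ∀ {φ}, φ ∈ T → common φ ∈ T

/-- Closure of a set of formulas under the `ω`-rule. -/
def OmegaClosed (T : Set (Formula I)) : Prop :=
  ∀ (φ : ℕ → Formula I) (ψ : Formula I),
    (∀ n, imp (φ n) (Formula.and (everyone ψ) (everyone (φ (n + 1)))) ∈ T) →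
      imp (φ 0) (common ψ) ∈ T

namespace IsTheory

variable (hT : IsTheory T)
include hT

theorem mem_of_foldr_imp {l : List (Formula I)} {φ : Formula I} (hl : ∀ ψ ∈ l, ψ ∈ T)
    (h : l.foldr imp φ ∈ T) : φ ∈ T := by
  induction l with
  | nil => exact h
  | cons ψ l ih =>
    rw [List.forall_mem_cons] at hl
    exact ih hl.2 (hT.mp hl.1 h)

/-- Strong completeness of `T` with respect to its points. -/
theorem exists_list_of_entails {Γ : Set (Formula I)} {φ : Formula I}
    (h : ∀ x : Point T, (∀ ψ ∈ Γ, x ψ) → x φ) :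
    ∃ l : List (Formula I), (∀ ψ ∈ l, ψ ∈ Γ) ∧ l.foldr imp φ ∈ T := by
  classical
  obtain ⟨F, hF, hent⟩ := exists_finset_entails (S := T ∪ Γ) (φ := φ) fun e he hS =>
    h ⟨e, he, fun χ hχ => hS χ (Or.inl hχ)⟩ fun ψ hψ => hS ψ (Or.inr hψ)
  refine ⟨(F.filter (· ∈ Γ)).toList, by simp, ?_⟩
  refine hT.mem_of_foldr_imp (l := (F.filter (· ∈ T)).toList) (by simp) (hT.ax (.taut ?_))
  refine isTautology_of_forall fun e he => ?_
  rw [he.foldr_imp_iff, he.foldr_imp_iff]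
  intro h₁ h₂
  refine hent e he fun χ hχ => ?_
  rcases hF hχ with hχ' | hχ'
  · exact h₁ χ (by simp [hχ, hχ'])
  · exact h₂ χ (by simp [hχ, hχ'])

theorem mem_iff_forall_point {φ : Formula I} : φ ∈ T ↔ ∀ x : Point T, x φ := by
  refine ⟨fun h x => x.holds_of_mem h, fun h => ?_⟩
  obtain ⟨l, hl, hφ⟩ := hT.exists_list_of_entails (Γ := ∅) (φ := φ) fun x _ => h x
  exact hT.mem_of_foldr_imp (fun ψ hψ => (hl ψ hψ).elim) hφ

theorem imp_mem_iff {φ ψ : Formula I} : imp φ ψ ∈ T ↔ ∀ x : Point T, x φ → x ψ := by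
  rw [hT.mem_iff_forall_point]
  exact forall_congr' fun x => x.isAssignment.imp_iff _ _

theorem box_imp {x : Point T} {i : I} {φ ψ : Formula I} (h : x (box i (imp φ ψ)))
    (hφ : x (box i φ)) : x (box i ψ) :=
  hT.imp_mem_iff.1 (hT.ax (.box_k i φ ψ)) x h |> (x.isAssignment.imp_iff _ _).1 <| hφ

theorem of_box {x : Point T} {i : I} {φ : Formula I} (h : x (box i φ)) : x φ :=
  hT.imp_mem_iff.1 (hT.ax (.box_t i φ)) x h

theorem box_box {x : Point T} {i : I} {φ : Formula I} (h : x (box i φ)) : x (box i (box i φ)) :=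
  hT.imp_mem_iff.1 (hT.ax (.box_four i φ)) x h

theorem box_of_common {x : Point T} {φ : Formula I} (h : x (common φ)) (i : I) : x (box i φ) := by
  have := hT.imp_mem_iff.1 (hT.ax (.common_fix φ)) x h
  rw [x.isAssignment.and_iff, x.isAssignment.everyone_iff] at this
  exact this.1 i

theorem box_common {x : Point T} {φ : Formula I} (h : x (common φ)) (i : I) :
    x (box i (common φ)) := by
  have := hT.imp_mem_iff.1 (hT.ax (.common_fix φ)) x h
  rw [x.isAssignment.and_iff, x.isAssignment.everyone_iff, x.isAssignment.everyone_iff] at this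
  exact this.2 i

theorem of_common [Nonempty I] {x : Point T} {φ : Formula I} (h : x (common φ)) : x φ :=
  hT.of_box (hT.box_of_common h (Classical.arbitrary I))

theorem box_of_mem {φ : Formula I} (h : φ ∈ T) (i : I) (x : Point T) : x (box i φ) :=
  hT.box_of_common (x.holds_of_mem (hT.nec h)) i

theorem box_mono {φ ψ : Formula I} (h : ∀ x : Point T, x φ → x ψ) {i : I} {x : Point T}
    (hx : x (box i φ)) : x (box i ψ) :=
  hT.box_imp (hT.box_of_mem (hT.imp_mem_iff.2 h) i x) hx

theorem common_mono {φ ψ : Formula I} (h : ∀ x : Point T, x φ → x ψ) {x : Point T}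
    (hx : x (common φ)) : x (common ψ) :=
  hT.imp_mem_iff.1 (hT.ax (.common_k φ ψ)) x (x.holds_of_mem (hT.nec (hT.imp_mem_iff.2 h)))
    |> (x.isAssignment.imp_iff _ _).1 <| hx

theorem box_foldr_imp {x : Point T} {i : I} {l : List (Formula I)} {φ : Formula I}
    (hl : ∀ ψ ∈ l, x (box i ψ)) (h : x (box i (l.foldr imp φ))) : x (box i φ) := by
  induction l with
  | nil => exact h
  | cons ψ l ih =>
    rw [List.forall_mem_cons] at hl
    exact ih hl.2 (hT.box_imp h hl.1)

/-- Where `□_i φ` fails, some point refutes `φ` and satisfies the same formulas `□_i ψ`. -/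
theorem exists_point_of_not_box {x : Point T} {i : I} {φ : Formula I} (h : ¬ x (box i φ)) :
    ∃ y : Point T, (∀ ψ, x (box i ψ) → y (box i ψ)) ∧ ¬ y φ := by
  by_contra! hy
  obtain ⟨l, hl, hmem⟩ := hT.exists_list_of_entails (Γ := {χ | x (box i χ)}) (φ := φ)
    fun y hΓ => hy y fun ψ hψ => hΓ _ (hT.box_box hψ)
  exact h (hT.box_foldr_imp hl (hT.box_of_mem hmem i x))

/-- An invariant formula satisfies `φ → C φ`, by the induction axiom. -/
theorem common_of_invariant [Nonempty I] {φ : Formula I}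
    (h : ∀ (i : I) (x : Point T), x φ → x (box i φ)) {x : Point T} (hx : x φ) : x (common φ) := by
  have hmem : imp φ (everyone φ) ∈ T :=
    hT.imp_mem_iff.2 fun y hy => (y.isAssignment.everyone_iff _).2 fun i => h i y hy
  refine hT.imp_mem_iff.1 (hT.ax (.common_ind φ)) x ?_
  rw [x.isAssignment.and_iff]
  exact ⟨hT.imp_mem_iff.1 hmem x hx, x.holds_of_mem (hT.nec hmem)⟩

end IsTheory

/-- The theorems of the finitary calculus. -/
theorem isTheory_provable : IsTheory {φ : Formula I | Provable φ} := ⟨.ax, .mp, .nec⟩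

theorem isTheory_globalDerivable (Δ : Set (Formula I)) :
    IsTheory {φ : Formula I | GlobalDerivable Δ φ} where
  ax {φ} h := ⟨.leaf φ, by rintro χ ⟨rfl, h'⟩; exact (h' h).elim⟩
  mp := fun ⟨p, hp⟩ ⟨q, hq⟩ => ⟨.mp p q, Set.union_subset hp hq⟩
  nec := fun ⟨p, hp⟩ => ⟨.nec p, hp⟩

theorem omegaClosed_globalDerivable (Δ : Set (Formula I)) :
    OmegaClosed {φ : Formula I | GlobalDerivable Δ φ} := by
  intro φ ψ h
  choose p hp using h
  exact ⟨.omega φ ψ p, Set.iUnion_subset hp⟩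

theorem globalDerivable_of_mem {Δ : Set (Formula I)} {φ : Formula I} (h : φ ∈ Δ) :
    GlobalDerivable Δ φ :=
  ⟨.leaf φ, by rintro χ ⟨rfl, -⟩; exact h⟩

end Theories

/-! ### The canonical topological model -/

section Canonical

variable {I : Type u} [Fintype I] {T : Set (Formula I)}

/-- The topology on the points of `T` with basic open sets `{x | x ⊨ □_i ψ}`. -/
@[reducible]
def canonicalTopology (hT : IsTheory T) (i : I) : TopologicalSpace (Point T) where
  IsOpen U := ∀ x ∈ U, ∃ ψ, x (box i ψ) ∧ ∀ y : Point T, y (box i ψ) → y ∈ U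
  isOpen_univ x _ := ⟨top, hT.box_of_mem (hT.ax (.taut (isTautology_of_forall fun _ he =>
    he.top_holds))) i x, fun _ _ => trivial⟩
  isOpen_inter U V hU hV x hx := by
    obtain ⟨φ, hφ, hφU⟩ := hU x hx.1
    obtain ⟨ψ, hψ, hψV⟩ := hV x hx.2
    have hand : imp φ (imp ψ (Formula.and φ ψ)) ∈ T :=
      hT.ax (.taut (isTautology_of_forall fun e he => by
        simp only [he.imp_iff, he.and_iff]
        exact And.intro))
    refine ⟨Formula.and φ ψ, hT.box_imp (hT.box_imp (hT.box_of_mem hand i x) hφ) hψ,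
      fun y hy => ⟨hφU y (hT.box_mono (fun z hz => ?_) hy), hψV y (hT.box_mono (fun z hz => ?_) hy)⟩⟩
    · exact ((z.isAssignment.and_iff _ _).1 hz).1
    · exact ((z.isAssignment.and_iff _ _).1 hz).2
  isOpen_sUnion S hS x := by
    rintro ⟨U, hU, hx⟩
    obtain ⟨ψ, hψ, hψU⟩ := hS U hU x hx
    exact ⟨ψ, hψ, fun y hy => ⟨U, hU, hψU y hy⟩⟩

theorem isOpen_canonicalTopology_iff (hT : IsTheory T) {i : I} {U : Set (Point T)} :
    IsOpen[canonicalTopology hT i] U ↔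
      ∀ x ∈ U, ∃ ψ, x (box i ψ) ∧ ∀ y : Point T, y (box i ψ) → y ∈ U :=
  Iff.rfl

/-- By compactness, an open set around the truth set of `χ` may be replaced by a finite union of
basic open sets. -/
theorem exists_box_of_truthSet_subset (hT : IsTheory T) {i : I} {U : Set (Point T)}
    (hU : IsOpen[canonicalTopology hT i] U) {χ : Formula I} (hχ : ∀ x : Point T, x χ → x ∈ U) :
    ∃ χ' : Formula I, (∀ x : Point T, x χ' → x ∈ U) ∧ ∀ x : Point T, x χ → x (box i χ') := by
  obtain ⟨l, hl, hmem⟩ := hT.exists_list_of_entails (φ := neg χ)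
    (Γ := {ξ | ∃ ψ, ξ = neg (box i ψ) ∧ ∀ y : Point T, y (box i ψ) → y ∈ U}) (by
      intro x hx
      rw [x.isAssignment.neg_iff]
      intro hxχ
      obtain ⟨ψ, hψ, hψU⟩ := hU x (hχ x hxχ)
      exact (x.isAssignment.neg_iff _).1 (hx _ ⟨ψ, rfl, hψU⟩) hψ)
  have hor : ∀ x : Point T, x (neg (conj l)) → ∃ ψ, x (box i ψ) ∧ neg (box i ψ) ∈ l ∧
      ∀ y : Point T, y (box i ψ) → y ∈ U := by
    intro x hx
    rw [x.isAssignment.neg_iff, x.isAssignment.conj_iff] at hx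
    push Not at hx
    obtain ⟨ξ, hξ, hxξ⟩ := hx
    obtain ⟨ψ, rfl, hψU⟩ := hl ξ hξ
    rw [x.isAssignment.neg_iff, not_not] at hxξ
    exact ⟨ψ, hxξ, hξ, hψU⟩
  refine ⟨neg (conj l), fun x hx => ?_, fun x hx => ?_⟩
  · obtain ⟨ψ, hψ, -, hψU⟩ := hor x hx
    exact hψU x hψ
  · have hxl : x (neg (conj l)) := by
      have := x.holds_of_mem hmem
      rw [x.isAssignment.foldr_imp_iff, x.isAssignment.neg_iff] at this
      rw [x.isAssignment.neg_iff, x.isAssignment.conj_iff]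
      exact fun h => this h hx
    obtain ⟨ψ, hψ, hψl, -⟩ := hor x hxl
    refine hT.box_mono (fun y hy => ?_) (hT.box_box hψ)
    rw [y.isAssignment.neg_iff, y.isAssignment.conj_iff]
    exact fun h => (y.isAssignment.neg_iff _).1 (h _ hψl) hy

/-- The set `U`, open in every topology, need not be defined by a formula. It is however exhausted
by formulas in the sense that, from any `χ` inside `U`, one can pass to `χ'` inside `U` with
`χ → E χ'`. -/
theorem exists_everyone_of_truthSet_subset (hT : IsTheory T) {U : Set (Point T)}
    (hU : ∀ i, IsOpen[canonicalTopology hT i] U) {χ : Formula I}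
    (hχ : ∀ x : Point T, x χ → x ∈ U) :
    ∃ χ' : Formula I, (∀ x : Point T, x χ' → x ∈ U) ∧ ∀ x : Point T, x χ → x (everyone χ') := by
  choose f hfU hf using fun i => exists_box_of_truthSet_subset hT (hU i) hχ
  -- `χ'` is the disjunction of all `f i`
  obtain ⟨χ', hor⟩ : ∃ χ' : Formula I, ∀ x : Point T, x χ' ↔ ∃ i, x (f i) :=
    ⟨neg (conj ((Finset.univ : Finset I).toList.map fun i => neg (f i))), fun x => by
      simp [x.isAssignment.neg_iff, x.isAssignment.conj_iff]⟩
  refine ⟨χ', fun x hx => ?_, fun x hx => (x.isAssignment.everyone_iff _).2 fun i => ?_⟩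
  · obtain ⟨i, hi⟩ := (hor x).1 hx
    exact hfU i x hi
  · exact hT.box_mono (fun y hy => (hor y).2 ⟨i, hy⟩) (hf i x hx)

/-- The canonical model of an `ω`-closed theory: the value of a formula is its truth set. -/
def canonicalModel [Nonempty I] (hT : IsTheory T) (hω : OmegaClosed T) : TopModel.{u, u} I where
  X := Point T
  τ := canonicalTopology hT
  val φ := {x | x φ}
  val_bot := Set.eq_empty_of_forall_notMem fun x => x.isAssignment.not_bot
  val_imp φ ψ := by
    ext x
    simp only [Set.mem_ofPred_eq, x.isAssignment.imp_iff, Set.mem_union, Set.mem_compl_iff]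
    tauto
  val_box i φ := by
    let _ := canonicalTopology hT i
    refine subset_antisymm (interior_maximal (fun x hx => hT.of_box hx)
      fun x hx => ⟨φ, hx, fun _ hy => hy⟩) fun x hx => ?_
    obtain ⟨U, hUφ, hU, hxU⟩ := mem_interior.1 hx
    obtain ⟨ψ, hψ, hψU⟩ := hU x hxU
    exact hT.box_mono (fun y hy => hUφ (hψU y hy)) (hT.box_box hψ)
  val_common φ := by
    let _ := ⨆ i, canonicalTopology hT i
    refine subset_antisymm (interior_maximal (fun x hx => hT.of_common hx) ?_) fun x hx => ?_
    · exact isOpen_iSup_iff.2 fun i x hx =>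
        ⟨common φ, hT.box_common hx i, fun y hy => hT.of_box hy⟩
    · obtain ⟨U, hUφ, hU, hxU⟩ := mem_interior.1 hx
      rw [isOpen_iSup_iff] at hU
      obtain ⟨ψ, hψ, hψU⟩ := hU (Classical.arbitrary I) x hxU
      choose! next hnextU hnext using
        fun (χ : Formula I) (hχ : ∀ x : Point T, x χ → x ∈ U) =>
          exists_everyone_of_truthSet_subset hT hU hχ
      let s : ℕ → Formula I := fun n => next^[n] (box (Classical.arbitrary I) ψ)
      have hs : ∀ n, s (n + 1) = next (s n) := fun n => Function.iterate_succ_apply' _ _ _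
      have hsU : ∀ n (y : Point T), y (s n) → y ∈ U := by
        intro n
        induction n with
        | zero => exact hψU
        | succ n ih => rw [hs]; exact hnextU _ ih
      refine hT.imp_mem_iff.1 (hω s φ fun n => hT.imp_mem_iff.2 fun y hy => ?_) x hψ
      have hy' := hnext (s n) (hsU n) y hy
      rw [← hs] at hy'
      refine (y.isAssignment.and_iff _ _).2 ⟨?_, hy'⟩
      rw [y.isAssignment.everyone_iff] at hy' ⊢
      exact fun i => hT.box_mono (fun z hz => hUφ (hsU (n + 1) z hz)) (hy' i)

end Canonical

/-! ### Algebraic soundness -/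

section Soundness

variable {I : Type u} {A : Type v} [BooleanAlgebra A]

/-- A non-top element of a Boolean algebra is avoided by an ultrafilter, which turns a valuation
into a truth assignment. -/
theorem val_eq_top_of_isTautology {val : Formula I → A} (hbot : val bot = ⊥)
    (himp : ∀ φ ψ, val (imp φ ψ) = val φ ⇨ val ψ) {φ : Formula I} (h : IsTautology φ) :
    val φ = ⊤ := by
  by_contra hφ
  obtain ⟨J, hJ, hle, -⟩ := DistribLattice.prime_ideal_of_disjoint_filter_ideal
    (F := Order.PFilter.principal (⊤ : A)) (I := Order.Ideal.principal (val φ)) (by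
      rw [Set.disjoint_left]
      intro a ha hb
      exact hφ (top_le_iff.1 (le_trans ha hb)))
  have hφJ : val φ ∈ J := hle (le_refl (val φ))
  refine h (fun χ => val χ ∉ J) (by simp [hbot]) (fun α β => ?_) hφJ
  rw [himp, himp_eq, Order.Ideal.sup_mem_iff]
  have hc : (val α)ᶜ ∈ J ↔ val α ∉ J := by
    constructor
    · intro h₁ h₂
      refine hJ.toIsProper.ne_univ (Set.eq_univ_of_forall fun a => ?_)
      exact J.lower le_top (by simpa using J.sup_mem h₂ h₁)
    · exact fun h₁ => hJ.mem_or_compl_mem.resolve_left h₁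
  rw [hc]
  tauto

variable [Fintype I]

namespace CKAlgebra.IsValuation

variable {𝒜 : CKAlgebra I A} {val : Formula I → A} (hv : 𝒜.IsValuation val)
include hv

theorem map_neg (φ : Formula I) : val (neg φ) = (val φ)ᶜ := by
  simp [Formula.neg, hv.map_imp, hv.map_bot]

theorem map_and (φ ψ : Formula I) : val (Formula.and φ ψ) = val φ ⊓ val ψ := by
  simp [Formula.and, hv.map_neg, hv.map_imp, himp_eq, compl_sup, inf_comm]

theorem le_conj {a : A} {l : List (Formula I)} : a ≤ val (conj l) ↔ ∀ φ ∈ l, a ≤ val φ := by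
  induction l with
  | nil => simp [conj, Formula.top, hv.map_neg, hv.map_bot]
  | cons φ l ih =>
    cases l with
    | nil => simp [conj]
    | cons ψ l => rw [conj, hv.map_and, le_inf_iff, ih, List.forall_mem_cons (a := φ)]

theorem map_everyone (φ : Formula I) : val (Formula.everyone φ) = 𝒜.everyone (val φ) := by
  refine eq_of_forall_le_iff fun a => ?_
  simp [Formula.everyone, hv.le_conj, CKAlgebra.everyone, Finset.le_inf_iff, hv.map_box]

theorem imp_eq_top {φ ψ : Formula I} : val (imp φ ψ) = ⊤ ↔ val φ ≤ val ψ := by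
  rw [hv.map_imp, himp_eq_top_iff]

theorem map_isAxiom {φ : Formula I} (h : IsAxiom φ) : val φ = ⊤ := by
  have hK : ∀ {f : A → A}, IsInteriorOperator f → ∀ a b, f (a ⇨ b) ≤ f a ⇨ f b := by
    intro f hf a b
    rw [le_himp_iff, ← hf.map_inf, himp_inf_self, hf.map_inf]
    exact inf_le_left
  cases h with
  | taut h => exact val_eq_top_of_isTautology hv.map_bot hv.map_imp h
  | box_k i φ ψ =>
    rw [hv.imp_eq_top, hv.map_box, hv.map_imp, hv.map_imp, hv.map_box, hv.map_box]
    exact hK (𝒜.box_interior i) _ _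
  | box_four i φ =>
    rw [hv.imp_eq_top, hv.map_box i (.box i φ), hv.map_box]
    exact ((𝒜.box_interior i).idem _).le
  | box_t i φ =>
    rw [hv.imp_eq_top, hv.map_box]
    exact (𝒜.box_interior i).le_self _
  | common_k φ ψ =>
    rw [hv.imp_eq_top, hv.map_common, hv.map_imp, hv.map_imp, hv.map_common, hv.map_common]
    exact hK 𝒜.common_interior _ _
  | common_fix φ =>
    rw [hv.imp_eq_top, hv.map_and, hv.map_everyone, hv.map_everyone, hv.map_common]
    exact 𝒜.common_le _
  | common_ind φ =>
    rw [hv.imp_eq_top, hv.map_and, hv.map_everyone, hv.map_common, hv.map_common, hv.map_imp,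
      hv.map_everyone]
    exact 𝒜.ind _

theorem map_provable {φ : Formula I} (h : Provable φ) : val φ = ⊤ := by
  induction h with
  | ax h => exact hv.map_isAxiom h
  | mp _ _ ih₁ ih₂ => rwa [hv.imp_eq_top, ih₁, top_le_iff] at ih₂
  | nec _ ih => rw [hv.map_common, ih, 𝒜.common_interior.map_top]

theorem map_omegaDerivation (hs : 𝒜.IsStandard) {Δ : Set (Formula I)}
    (hΔ : ∀ ξ ∈ Δ, val ξ = ⊤) {φ : Formula I} (π : OmegaDerivation φ)
    (hπ : π.assumptions ⊆ Δ) : val φ = ⊤ := by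
  induction π with
  | leaf φ =>
    by_cases h : IsAxiom φ
    · exact hv.map_isAxiom h
    · exact hΔ φ (hπ ⟨rfl, h⟩)
  | mp p q ihp ihq =>
    have h₁ := ihp (Set.subset_union_left.trans hπ)
    have h₂ := ihq (Set.subset_union_right.trans hπ)
    rwa [hv.imp_eq_top, h₁, top_le_iff] at h₂
  | nec p ih => rw [hv.map_common, ih hπ, 𝒜.common_interior.map_top]
  | omega φ ψ p ih =>
    rw [hv.imp_eq_top, hv.map_common]
    refine hs (val ψ) (fun n => val (φ n)) fun n => ?_
    have := ih n ((Set.subset_iUnion (fun n => (p n).assumptions) n).trans hπ)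
    rwa [hv.imp_eq_top, hv.map_and, hv.map_everyone, hv.map_everyone] at this

end CKAlgebra.IsValuation

theorem LocalDerivable.algLocalConsequence {Γ : Set (Formula I)} {φ : Formula I}
    (h : LocalDerivable Γ φ) : AlgLocalConsequence.{u, v} Γ φ := by
  intro A _ 𝒜 _ val hv F hF
  obtain ⟨Γ₀, hΓ₀, hφ⟩ := h
  refine F.mem_of_le (hv.imp_eq_top.1 (hv.map_provable hφ)) ?_
  have key : ∀ l : List (Formula I), (∀ ψ ∈ l, val ψ ∈ F) → val (conj l) ∈ F := by
    intro l hl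
    induction l with
    | nil =>
      rw [show val (conj []) = ⊤ by simp [conj, Formula.top, hv.map_neg, hv.map_bot]]
      exact F.top_mem
    | cons ψ l ih =>
      rw [List.forall_mem_cons] at hl
      refine F.mem_of_le (hv.le_conj.2 ?_) (F.inf_mem hl.1 (ih hl.2))
      rw [List.forall_mem_cons]
      exact ⟨inf_le_left, fun χ hχ => inf_le_right.trans (hv.le_conj.1 le_rfl χ hχ)⟩
  exact key _ fun ψ hψ => hF ⟨ψ, hΓ₀ (by simpa using hψ), rfl⟩

theorem GlobalDerivable.algGlobalConsequence {Δ : Set (Formula I)} {φ : Formula I}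
    (h : GlobalDerivable Δ φ) : AlgGlobalConsequence.{u, v} Δ φ := by
  intro A _ 𝒜 hs val hv hΔ
  obtain ⟨π, hπ⟩ := h
  exact hv.map_omegaDerivation hs hΔ π hπ

end Soundness

/-! ### The algebra of subsets of a topological model -/

section Powerset

variable {I : Type u}

theorem mem_univ_inf [Fintype I] {X : Type w} {f : I → Set X} {x : X} :
    x ∈ Finset.univ.inf f ↔ ∀ i, x ∈ f i := by
  simp [Finset.inf_set_eq_iInter]

theorem isInteriorOperator_interior {X : Type w} (t : TopologicalSpace X) :
    IsInteriorOperator (fun s : Set X => @interior X t s) where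
  map_top := interior_univ
  map_inf _ _ := interior_inter
  idem _ := interior_interior.symm
  le_self _ := interior_subset

/-- A set is contained in the common interior of `d` as soon as it is contained in `d` and open in
every topology. -/
theorem subset_interior_iSup {X : Type w} {τ : I → TopologicalSpace X} {U d : Set X} (hUd : U ⊆ d)
    (hU : ∀ i, U ⊆ @interior X (τ i) U) : U ⊆ @interior X (⨆ i, τ i) d :=
  let _ := ⨆ i, τ i
  interior_maximal hUd (isOpen_iSup_iff.2 fun i => (@subset_interior_iff_isOpen X (τ i) U).1 (hU i))

theorem interior_iSup_subset {X : Type w} (τ : I → TopologicalSpace X) (s : Set X) (i : I) :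
    @interior X (⨆ i, τ i) s ⊆ @interior X (τ i) (@interior X (⨆ i, τ i) s) :=
  (@subset_interior_iff_isOpen X (τ i) _).2
    (isOpen_iSup_iff.1 (@isOpen_interior X (⨆ i, τ i) s) i)

variable [Fintype I]

/-- The algebra of all subsets of a set with topologies `τ i`. -/
def powersetAlgebra [Nonempty I] {X : Type w} (τ : I → TopologicalSpace X) :
    CKAlgebra I (Set X) where
  box i s := @interior X (τ i) s
  common s := @interior X (⨆ i, τ i) s
  box_interior i := isInteriorOperator_interior (τ i)
  common_interior := isInteriorOperator_interior _
  common_le s := by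
    refine le_inf (fun x hx => mem_univ_inf.2 fun i => ?_)
      (fun x hx => mem_univ_inf.2 fun i => interior_iSup_subset τ s i hx)
    exact (@interior_mono X (τ i) _ _ (@interior_subset X (⨆ i, τ i) s))
      (interior_iSup_subset τ s i hx)
  ind s := by
    have hle : ∀ i, @interior X (τ i) s ⊆ s := fun i => @interior_subset X (τ i) s
    have hN : @interior X (⨆ i, τ i) (s ⇨ Finset.univ.inf fun i => @interior X (τ i) s) ⊆
        s ⇨ Finset.univ.inf fun i => @interior X (τ i) s := @interior_subset X (⨆ i, τ i) _
    -- With `N` the common interior of `s ⇨ E s`, the set `E s ∩ N` equals `N ∩ int_i s`.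
    refine subset_interior_iSup (fun x hx => hle (Classical.arbitrary I) (mem_univ_inf.1 hx.1 _))
      fun i x hx => ?_
    have hx' : x ∈ @interior X (τ i) (@interior X (τ i) s ∩
        @interior X (⨆ i, τ i) (s ⇨ Finset.univ.inf fun i => @interior X (τ i) s)) := by
      rw [@interior_inter X (τ i), @interior_interior X (τ i)]
      exact ⟨mem_univ_inf.1 hx.1 i, interior_iSup_subset τ _ i hx.2⟩
    refine (@interior_mono X (τ i) _ _ ?_) hx'
    intro y hy
    have h := hN hy.2
    rw [himp_eq] at h
    exact ⟨h.resolve_right fun h' => h' (hle i hy.1), hy.2⟩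

theorem isStandard_powersetAlgebra [Nonempty I] {X : Type w} (τ : I → TopologicalSpace X) :
    (powersetAlgebra τ).IsStandard := by
  intro d a h
  have h₁ : ∀ j i, a j ⊆ @interior X (τ i) d := fun j i x hx => mem_univ_inf.1 (h j hx).1 i
  have h₂ : ∀ j i, a j ⊆ @interior X (τ i) (a (j + 1)) := fun j i x hx => mem_univ_inf.1 (h j hx).2 i
  refine (Set.subset_iUnion a 0).trans (subset_interior_iSup (Set.iUnion_subset fun j =>
    (h₁ j (Classical.arbitrary I)).trans (@interior_subset X (τ _) d)) fun i => ?_)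
  exact Set.iUnion_subset fun j =>
    (h₂ j i).trans (@interior_mono X (τ i) _ _ (Set.subset_iUnion a (j + 1)))

theorem TopModel.isValuation [Nonempty I] (M : TopModel.{u, w} I) :
    (powersetAlgebra M.τ).IsValuation M.val where
  map_bot := M.val_bot
  map_imp φ ψ := by rw [M.val_imp, himp_eq]; rfl
  map_box := M.val_box
  map_common := M.val_common

theorem AlgLocalConsequence.topLocalConsequence [Nonempty I] {Γ : Set (Formula I)}
    {φ : Formula I} (h : AlgLocalConsequence.{u, w} Γ φ) : TopLocalConsequence.{u, w} Γ φ := by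
  intro M x hx
  have := h (Set M.X) (powersetAlgebra M.τ) (isStandard_powersetAlgebra M.τ) M.val M.isValuation
    (Order.PFilter.principal {x}) (by
      rintro _ ⟨ψ, hψ, rfl⟩
      exact Set.singleton_subset_iff.2 (hx ψ hψ))
  exact Set.singleton_subset_iff.1 this

theorem AlgGlobalConsequence.topGlobalConsequence [Nonempty I] {Δ : Set (Formula I)}
    {φ : Formula I} (h : AlgGlobalConsequence.{u, w} Δ φ) : TopGlobalConsequence.{u, w} Δ φ := by
  intro M hM
  exact Set.eq_univ_iff_forall.1 (h (Set M.X) (powersetAlgebra M.τ)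
    (isStandard_powersetAlgebra M.τ) M.val M.isValuation
    fun ξ hξ => Set.eq_univ_iff_forall.2 (hM ξ hξ))

end Powerset

/-! ### Filtration: admissibility of the `ω`-rule -/

section Filtration

variable {I : Type u}

/-- The value of a formula determined by topologies and the values of the variables. -/
def interpretation {X : Type w} (τ : I → TopologicalSpace X) (p : ℕ → Set X) :
    Formula I → Set X
  | var n => p n
  | bot => ∅
  | imp φ ψ => interpretation τ p ψ ∪ (interpretation τ p φ)ᶜ
  | box i φ => @interior X (τ i) (interpretation τ p φ)
  | common φ => @interior X (⨆ i, τ i) (interpretation τ p φ)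

/-- The topological model determined by topologies and the values of the variables. -/
def interpretationModel {X : Type w} (τ : I → TopologicalSpace X) (p : ℕ → Set X) :
    TopModel.{u, w} I where
  X := X
  τ := τ
  val := interpretation τ p
  val_bot := rfl
  val_imp _ _ := rfl
  val_box _ _ := rfl
  val_common _ := rfl

variable {T : Set (Formula I)}

/-- A set of points that is invariant under agreement on finitely many formulas is defined by a
formula. -/
theorem exists_formula_of_invariant (l : List (Formula I)) {D : Set (Point T)}
    (hD : ∀ x y : Point T, (∀ χ ∈ l, x χ ↔ y χ) → x ∈ D → y ∈ D) :
    ∃ δ : Formula I, ∀ x : Point T, x δ ↔ x ∈ D := by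
  induction l generalizing D with
  | nil =>
    by_cases h : ∃ x, x ∈ D
    · obtain ⟨x, hx⟩ := h
      exact ⟨top, fun y => iff_of_true y.isAssignment.top_holds (hD x y (by simp) hx)⟩
    · exact ⟨bot, fun y => iff_of_false y.isAssignment.not_bot fun hy => h ⟨y, hy⟩⟩
  | cons χ l ih =>
    obtain ⟨δ₁, h₁⟩ := ih (D := {x | ∃ y ∈ D, y χ ∧ ∀ ψ ∈ l, x ψ ↔ y ψ})
      fun x x' hx ⟨y, hy, hyχ, hxy⟩ => ⟨y, hy, hyχ, fun ψ hψ => (hx ψ hψ).symm.trans (hxy ψ hψ)⟩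
    obtain ⟨δ₂, h₂⟩ := ih (D := {x | ∃ y ∈ D, ¬ y χ ∧ ∀ ψ ∈ l, x ψ ↔ y ψ})
      fun x x' hx ⟨y, hy, hyχ, hxy⟩ => ⟨y, hy, hyχ, fun ψ hψ => (hx ψ hψ).symm.trans (hxy ψ hψ)⟩
    refine ⟨Formula.and (imp χ δ₁) (imp (neg χ) δ₂), fun x => ?_⟩
    rw [x.isAssignment.and_iff, x.isAssignment.imp_iff, x.isAssignment.imp_iff,
      x.isAssignment.neg_iff, h₁, h₂]
    constructor
    · rintro ⟨ha, hb⟩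
      by_cases hx : x χ
      · obtain ⟨y, hy, hyχ, hxy⟩ := ha hx
        refine hD y x ?_ hy
        rw [List.forall_mem_cons]
        exact ⟨iff_of_true hyχ hx, fun ψ hψ => (hxy ψ hψ).symm⟩
      · obtain ⟨y, hy, hyχ, hxy⟩ := hb hx
        refine hD y x ?_ hy
        rw [List.forall_mem_cons]
        exact ⟨iff_of_false hyχ hx, fun ψ hψ => (hxy ψ hψ).symm⟩
    · exact fun hx => ⟨fun h => ⟨x, hx, h, fun _ _ => Iff.rfl⟩,
        fun h => ⟨x, hx, h, fun _ _ => Iff.rfl⟩⟩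

/-- The preorder of the filtration through `Φ`: `y` satisfies all formulas `□_i χ` from `Φ` that
`x` satisfies. -/
def filtrationRel (Φ : List (Formula I)) (i : I) (x y : Point T) : Prop :=
  ∀ χ, box i χ ∈ Φ → x (box i χ) → y (box i χ)

/-- The topology of up-sets of `filtrationRel Φ i`. -/
@[reducible]
def filtrationTopology (T : Set (Formula I)) (Φ : List (Formula I)) (i : I) :
    TopologicalSpace (Point T) where
  IsOpen U := ∀ x ∈ U, ∀ y, filtrationRel Φ i x y → y ∈ U
  isOpen_univ _ _ _ _ := trivial
  isOpen_inter _ _ hU hV x hx y hxy := ⟨hU x hx.1 y hxy, hV x hx.2 y hxy⟩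
  isOpen_sUnion _ hS := fun x ⟨U, hU, hx⟩ y hxy => ⟨U, hU, hS U hU x hx y hxy⟩

variable [Fintype I]

/-- The subformulas `□_i ψ` of a formula, and the formulas `□_i C ψ` for its subformulas `C ψ`. Only
boxed formulas enter the filtration relation; `C ψ` is equivalent to `□_i C ψ`, and the truth values
of variables play no role for the topologies. -/
noncomputable def filtrationList : Formula I → List (Formula I)
  | var _ => []
  | bot => []
  | imp φ ψ => filtrationList φ ++ filtrationList ψ
  | box i φ => box i φ :: filtrationList φ
  | common φ =>
      filtrationList φ ++ (Finset.univ : Finset I).toList.map fun i => box i (common φ)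

/-- The truth lemma for the filtration through `Φ`. -/
theorem mem_interpretation_filtration_iff [Nonempty I] (hT : IsTheory T) (Φ : List (Formula I))
    {φ : Formula I} (hφ : filtrationList φ ⊆ Φ) (x : Point T) :
    x ∈ interpretation (filtrationTopology T Φ) (fun n => {y | y (var n)}) φ ↔ x φ := by
  induction φ generalizing x with
  | var n => exact Iff.rfl
  | bot => exact iff_of_false (Set.notMem_empty x) x.isAssignment.not_bot
  | imp φ ψ ih₁ ih₂ =>
    simp only [filtrationList, List.append_subset] at hφ
    rw [x.isAssignment.imp_iff, interpretation, Set.mem_union, Set.mem_compl_iff, ih₁ hφ.1,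
      ih₂ hφ.2]
    tauto
  | box i φ ih =>
    simp only [filtrationList, List.cons_subset] at hφ
    let _ := filtrationTopology T Φ i
    rw [interpretation, mem_interior]
    constructor
    · rintro ⟨U, hUφ, hU, hx⟩
      by_contra hbox
      obtain ⟨y, hxy, hy⟩ := hT.exists_point_of_not_box hbox
      exact hy ((ih hφ.2 y).1 (hUφ (hU x hx y fun χ _ => hxy χ)))
    · intro hx
      exact ⟨{y | y (box i φ)}, fun y hy => (ih hφ.2 y).2 (hT.of_box hy),
        fun y hy z hyz => hyz φ hφ.1 hy, hx⟩
  | common φ ih =>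
    simp only [filtrationList, List.append_subset] at hφ
    let _ := ⨆ i, filtrationTopology T Φ i
    rw [interpretation, mem_interior]
    constructor
    · rintro ⟨U, hUφ, hU, hx⟩
      rw [isOpen_iSup_iff] at hU
      -- points that agree on `Φ` are related, so open sets are invariant under agreement
      obtain ⟨δ, hδ⟩ := exists_formula_of_invariant Φ (D := U) fun y z hyz hy =>
        hU (Classical.arbitrary I) y hy z fun χ hχ => (hyz _ hχ).1
      refine hT.common_mono (fun y hy => (ih hφ.1 y).1 (hUφ ((hδ y).1 hy)))
        (hT.common_of_invariant (fun i y hy => ?_) ((hδ x).2 hx))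
      by_contra hbox
      obtain ⟨z, hyz, hz⟩ := hT.exists_point_of_not_box hbox
      exact hz ((hδ z).2 (hU i y ((hδ y).1 hy) z fun χ _ => hyz χ))
    · intro hx
      refine ⟨{y | y (common φ)}, fun y hy => (ih hφ.1 y).2 (hT.of_common hy),
        isOpen_iSup_iff.2 fun i y hy z hyz => ?_, hx⟩
      exact hT.of_box (hyz (common φ) (hφ.2 (by simp)) (hT.box_common hy i))

/-- Every formula `ω`-derivable without assumptions is provable in the finitary calculus. -/
theorem provable_of_globalDerivable_empty [Nonempty I] {φ : Formula I}
    (h : GlobalDerivable ∅ φ) : Provable φ := by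
  have hT := isTheory_provable (I := I)
  refine hT.mem_iff_forall_point.2 fun x => ?_
  rw [← mem_interpretation_filtration_iff hT _ (List.Subset.refl (filtrationList φ))]
  exact h.algGlobalConsequence.topGlobalConsequence (interpretationModel _ _) (by simp) x

theorem omegaClosed_provable [Nonempty I] : OmegaClosed {φ : Formula I | Provable φ} := by
  have hsub : ∀ {φ : Formula I}, Provable φ → GlobalDerivable ∅ φ := by
    intro φ h
    induction h with
    | ax h => exact (isTheory_globalDerivable ∅).ax h
    | mp _ _ ih₁ ih₂ => exact (isTheory_globalDerivable ∅).mp ih₁ ih₂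
    | nec _ ih => exact (isTheory_globalDerivable ∅).nec ih
  exact fun φ ψ h =>
    provable_of_globalDerivable_empty (omegaClosed_globalDerivable ∅ φ ψ fun n => hsub (h n))

end Filtration

/-! ### Change of universe and completeness -/

section Completeness

variable {I : Type u}

/-- Renaming of the agents in a formula. -/
def Formula.mapAgents {J : Type v} (f : I → J) : Formula I → Formula J
  | var n => var n
  | bot => bot
  | imp φ ψ => imp (φ.mapAgents f) (ψ.mapAgents f)
  | box i φ => box (f i) (φ.mapAgents f)
  | common φ => common (φ.mapAgents f)

theorem Formula.mapAgents_injective {J : Type v} {f : I → J} (hf : Function.Injective f) :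
    Function.Injective (Formula.mapAgents f) := by
  intro φ
  induction φ with
  | var n => intro ψ h; cases ψ <;> simp_all [Formula.mapAgents]
  | bot => intro ψ h; cases ψ <;> simp_all [Formula.mapAgents]
  | imp φ₁ φ₂ ih₁ ih₂ =>
    intro ψ h
    cases ψ <;> simp only [Formula.mapAgents, imp.injEq, reduceCtorEq] at h
    rw [ih₁ h.1, ih₂ h.2]
  | box i φ ih =>
    intro ψ h
    cases ψ <;> simp only [Formula.mapAgents, box.injEq, reduceCtorEq] at h
    rw [hf h.1, ih h.2]
  | common φ ih =>
    intro ψ h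
    cases ψ <;> simp only [Formula.mapAgents, common.injEq, reduceCtorEq] at h
    rw [ih h]

/-- Renaming the agents by a numbering embeds the formulas into the lowest universe. -/
instance [Finite I] : Small.{w} (Formula I) := by
  obtain ⟨n, ⟨e⟩⟩ := Finite.exists_equiv_fin I
  exact small_of_injective (Formula.mapAgents_injective e.injective)

instance [Fintype I] (T : Set (Formula I)) : Small.{w} (Point T) :=
  inferInstanceAs (Small.{w} {e : Formula I → Prop // IsAssignment e ∧ ∀ φ ∈ T, e φ})

theorem interior_coinduced_equiv {X : Type v} {Y : Type w} (f : X ≃ Y) (t : TopologicalSpace X)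
    (s : Set X) :
    @interior Y (t.coinduced f) (f.symm ⁻¹' s) = f.symm ⁻¹' (@interior X t s) := by
  let _ := t.coinduced f
  have hf : Topology.IsInducing f.symm := ⟨congrFun f.induced_symm.symm t⟩
  exact ((f.symm.toHomeomorphOfIsInducing hf).preimage_interior s).symm

/-- Transport of a topological model along a bijection. -/
def TopModel.transport (M : TopModel.{u, v} I) {Y : Type w} (f : M.X ≃ Y) : TopModel.{u, w} I where
  X := Y
  τ i := (M.τ i).coinduced f
  val φ := f.symm ⁻¹' M.val φ
  val_bot := by rw [M.val_bot, Set.preimage_empty]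
  val_imp φ ψ := by rw [M.val_imp, Set.preimage_union, Set.preimage_compl]
  val_box i φ := by rw [M.val_box, interior_coinduced_equiv]
  val_common φ := by rw [M.val_common, ← coinduced_iSup, interior_coinduced_equiv]

variable [Fintype I] [Nonempty I]

/-- The truth sets of an `ω`-closed theory are the values of formulas in a topological model in any
universe. -/
theorem exists_topModel_of_omegaClosed {T : Set (Formula I)} (hT : IsTheory T)
    (hω : OmegaClosed T) :
    ∃ (M : TopModel.{u, w} I) (f : Point T ≃ M.X), ∀ x φ, M.TrueAt (f x) φ ↔ x φ := by
  let f := equivShrink.{w} (Point T)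
  refine ⟨(canonicalModel hT hω).transport f, f, fun x φ => ?_⟩
  change f.symm (f x) φ ↔ x φ
  rw [f.symm_apply_apply]

theorem TopLocalConsequence.localDerivable {Γ : Set (Formula I)} {φ : Formula I}
    (h : TopLocalConsequence.{u, w} Γ φ) : LocalDerivable Γ φ := by
  classical
  have hT := isTheory_provable (I := I)
  obtain ⟨M, f, hM⟩ := exists_topModel_of_omegaClosed.{u, w} hT omegaClosed_provable
  obtain ⟨l, hl, hmem⟩ := hT.exists_list_of_entails (Γ := Γ) (φ := φ) fun x hx =>
    (hM x φ).1 (h M (f x) fun ψ hψ => (hM x ψ).2 (hx ψ hψ))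
  refine ⟨l.toFinset, fun ψ hψ => hl ψ (by simpa using hψ), hT.mp hmem (hT.ax (.taut ?_))⟩
  refine isTautology_of_forall fun e he => ?_
  rw [he.imp_iff, he.imp_iff, he.foldr_imp_iff, he.conj_iff]
  simp

theorem TopGlobalConsequence.globalDerivable {Δ : Set (Formula I)} {φ : Formula I}
    (h : TopGlobalConsequence.{u, w} Δ φ) : GlobalDerivable Δ φ := by
  have hT := isTheory_globalDerivable Δ
  obtain ⟨M, f, hM⟩ := exists_topModel_of_omegaClosed.{u, w} hT (omegaClosed_globalDerivable Δ)
  refine hT.mem_iff_forall_point.2 fun x => (hM x φ).1 (h M (fun ξ hξ y => ?_) (f x))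
  obtain ⟨y, rfl⟩ := f.surjective y
  exact (hM y ξ).2 (y.holds_of_mem (globalDerivable_of_mem hξ))

end Completeness

end S4C

/-- Local and global completeness of `S4^C_I`; algebras and topological models may live in
arbitrary universes `v` and `w`. -/
theorem mainTheorem4 {I : Type u} [Fintype I] [Nonempty I] :
    (∀ (Γ : Set (S4C.Formula I)) (φ : S4C.Formula I),
      (S4C.LocalDerivable Γ φ ↔ S4C.AlgLocalConsequence.{u, v} Γ φ) ∧
      (S4C.AlgLocalConsequence.{u, v} Γ φ ↔ S4C.TopLocalConsequence.{u, w} Γ φ)) ∧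
    (∀ (Δ : Set (S4C.Formula I)) (φ : S4C.Formula I),
      (S4C.GlobalDerivable Δ φ ↔ S4C.AlgGlobalConsequence.{u, v} Δ φ) ∧
      (S4C.AlgGlobalConsequence.{u, v} Δ φ ↔ S4C.TopGlobalConsequence.{u, w} Δ φ)) := by
  -- Consequence over a fixed universe yields derivability, which passes to every other universe.
  refine ⟨fun Γ φ => ?_, fun Δ φ => ?_⟩
  · have halg : S4C.AlgLocalConsequence.{u, v} Γ φ → S4C.LocalDerivable Γ φ := fun h =>
      h.topLocalConsequence.localDerivable
    exact ⟨⟨fun h => h.algLocalConsequence, halg⟩,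
      ⟨fun h => (halg h).algLocalConsequence.topLocalConsequence,
        fun h => h.localDerivable.algLocalConsequence⟩⟩
  · have halg : S4C.AlgGlobalConsequence.{u, v} Δ φ → S4C.GlobalDerivable Δ φ := fun h =>
      h.topGlobalConsequence.globalDerivable
    exact ⟨⟨fun h => h.algGlobalConsequence, halg⟩,
      ⟨fun h => (halg h).algGlobalConsequence.topGlobalConsequence,
        fun h => h.globalDerivable.algGlobalConsequence⟩⟩
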